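/- Let $\lambda$ denote Lebesgue measure on $\mathbb{R}^2$, let $u\in(0,\infty)$ and $\alpha>0$, and let $\rho$ be a probability measure on $[1,\infty)$ for which there is a constant $c>0$ such that $c^{-1}r^{-\alpha}\le\rho[r,\infty)\le c\,r^{-\alpha}$ for every $r\ge 1$. Let $\nu$ be the uniform distribution on $(-\pi/2,\pi/2]$. For $(z,R,V)$ in $S=\mathbb{R}^2\times[1,\infty)\times(-\pi/2,\pi/2]$ let $E(z,R,V)\subset\mathbb{R}^2$ be the closed filled ellipse with center $z$, major semi-axis of length $R$ in direction $(\cos V,\sin V)$, and minor semi-axis of length $1$. Let $\xi$ be a Poisson point process on $S$ with intensity measure $(u\lambda)\otimes\rho\otimes\nu$, and let $$\mathcal{E}=\bigcup_{s\in\operatorname{supp}\xi}E(s)$$ be the covered set. Let $E_0=E(0,R,V)$ be the random ellipse centered at the origin, where $(R,V)$ has law $\rho\otimes\nu$. Then $$P[\mathcal{E}=\mathbb{R}^2]=1\quad\text{if and only if}\quad \mathbb{E}[\lambda(E_0)]=\infty .$$ -/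

import Mathlib

open MeasureTheory ProbabilityTheory

namespace EllipsesModel

noncomputable section

/-- A (Radon) point measure on `E`: a locally finite measure which is a countable sum of unit
point masses. -/
def IsPointMeasure {E : Type*} [TopologicalSpace E] [MeasurableSpace E] (m : Measure E) : Prop :=
  IsLocallyFiniteMeasure m ∧
    ∃ (ι : Type) (_ : Countable ι) (x : ι → E), m = Measure.sum fun i => Measure.dirac (x i)

/-- `ξ` is, under `P`, a Poisson point process on `E` with intensity measure `μ`: a random point
measure such that the number of points in a measurable set `B` has the Poisson distribution of
parameter `μ B` (and is almost surely infinite if `μ B = ∞`), and such that the numbers of points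
in disjoint measurable sets are independent. -/
structure IsPoissonPointProcess {Ω E : Type*} [MeasurableSpace Ω] [TopologicalSpace E]
    [MeasurableSpace E] (ξ : Ω → Measure E) (μ : Measure E) (P : Measure Ω) : Prop where
  measurable : Measurable ξ
  isPointMeasure : ∀ ω, IsPointMeasure (ξ ω)
  map_eq_poisson : ∀ B : Set E, MeasurableSet B → μ B ≠ ⊤ →
    P.map (fun ω => ξ ω B) =
      (poissonMeasure (μ B).toNNReal).map (fun n : ℕ => (n : ENNReal))
  ae_eq_top : ∀ B : Set E, MeasurableSet B → μ B = ⊤ → ∀ᵐ ω ∂P, ξ ω B = ⊤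
  indep : ∀ (n : ℕ) (B : Fin n → Set E), (∀ i, MeasurableSet (B i)) →
    Pairwise (fun i j => Disjoint (B i) (B j)) → iIndepFun (fun i ω => ξ ω (B i)) P

/-- The plane `ℝ²` with its Euclidean structure. -/
abbrev Plane : Type := EuclideanSpace ℝ (Fin 2)

/-- The interval `[1, ∞)` of major (semi-)axis lengths. -/
abbrev AxisLength : Type := Set.Ici (1 : ℝ)

/-- The interval `(-π/2, π/2]` of directions. -/
abbrev Direction : Type := Set.Ioc (-(Real.pi / 2)) (Real.pi / 2)

/-- The parameter space `S = ℝ² × [1, ∞) × (-π/2, π/2]` of ellipses. -/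
abbrev Params : Type := Plane × AxisLength × Direction

/-- The uniform distribution `ν` on the directions, an interval of length `π`. -/
def directionLaw : Measure Direction :=
  (ENNReal.ofReal Real.pi)⁻¹ • (volume : Measure ℝ).comap Subtype.val

/-- `ρ[r, ∞) ≍ r ^ (-α)` for `r ≥ 1`. -/
def HasTailDecay (ρ : Measure AxisLength) (α : ℝ) : Prop :=
  ∃ c : ℝ, 0 < c ∧ ∀ r : ℝ, 1 ≤ r →
    c⁻¹ * r ^ (-α) ≤ ρ.real {x | r ≤ (x : ℝ)} ∧ ρ.real {x | r ≤ (x : ℝ)} ≤ c * r ^ (-α)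

/-- The filled ellipse `E(z, R, V)` with center `z`, major semi-axis of length `R` in the direction
`(cos V, sin V)`, and minor semi-axis of length `1`. -/
def ellipse (z : Plane) (R V : ℝ) : Set Plane :=
  {p | (((p 0 - z 0) * Real.cos V + (p 1 - z 1) * Real.sin V) / R) ^ 2 +
      (-(p 0 - z 0) * Real.sin V + (p 1 - z 1) * Real.cos V) ^ 2 ≤ 1}

/-- The intensity measure `(u λ) ⊗ ρ ⊗ ν` on `S`. -/
def intensity (u : ℝ) (ρ : Measure AxisLength) : Measure Params :=
  (ENNReal.ofReal u • (volume : Measure Plane)).prod (ρ.prod directionLaw)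

/-- The covered set: the union of the ellipses `E(s)` over the points `s` of the support of the
configuration `m`. -/
def coveredSet (m : Measure Params) : Set Plane :=
  ⋃ s ∈ m.support, ellipse s.1 s.2.1 s.2.2

/-- The expected area `E[λ(E₀)]` of the ellipse `E₀` centered at the origin whose major semi-axis
and direction have joint law `ρ ⊗ ν`. -/
def expectedArea (ρ : Measure AxisLength) : ENNReal :=
  ∫⁻ q : AxisLength × Direction, volume (ellipse 0 q.1 q.2) ∂(ρ.prod directionLaw)

end

end EllipsesModel

namespace EllipsesModel

section PointMeasure

variable {E : Type*} [TopologicalSpace E] [MeasurableSpace E]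

/-! By translation invariance, the ellipses containing a given point have intensity `u` times the
expected area. If this is finite, the origin is missed with positive probability (`void_not_null`).
If it is infinite, so is the intensity of the ellipses whose half-size copies contain a given point.
Almost surely such ellipses then exist at every point of a countable dense set at once. Since minor
semi-axes have length 1, each full ellipse contains the disc of radius 1/2 about its point, and
these discs cover the plane. -/

theorem IsPointMeasure.exists_mem_support {m : Measure E} (hm : IsPointMeasure m) {B : Set E}
    (hB : MeasurableSet B) (h : m B ≠ 0) : ∃ x ∈ B, x ∈ m.support := by
  obtain ⟨-, ι, _, x, rfl⟩ := hm
  rw [Measure.sum_apply _ hB, Ne, ENNReal.tsum_eq_zero, not_forall] at h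
  obtain ⟨i, hi⟩ := h
  rw [Measure.dirac_apply' _ hB] at hi
  refine ⟨x i, by_contra fun hx => hi (Set.indicator_of_notMem hx _), ?_⟩
  rw [Measure.mem_support_iff_forall]
  intro U hU
  have h1 : 1 ≤ Measure.dirac (x i) U := by
    have := Measure.le_dirac_apply (a := x i) (s := U)
    rwa [Set.indicator_of_mem (mem_of_mem_nhds hU), Pi.one_apply] at this
  exact zero_lt_one.trans_le
    (h1.trans (Measure.le_sum (fun i => Measure.dirac (x i)) i U))

/-- Local finiteness prevents atoms from accumulating, so every point of the support is itself an
atom. -/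
theorem IsPointMeasure.measure_ne_zero_of_mem_support [T1Space E] [OpensMeasurableSpace E]
    {m : Measure E} (hm : IsPointMeasure m) {B : Set E} {y : E} (hy : y ∈ m.support)
    (hyB : y ∈ B) : m B ≠ 0 := by
  obtain ⟨hfin, ι, _, x, rfl⟩ := hm
  intro hB
  obtain ⟨U, hyU, hU, hUfin⟩ := (Measure.sum fun i => Measure.dirac (x i)).exists_isOpen_measure_lt_top y
  have hne : ∀ i, x i ≠ y := by
    rintro i rfl
    have h1 : 1 ≤ Measure.dirac (x i) B := by
      have := Measure.le_dirac_apply (a := x i) (s := B)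
      rwa [Set.indicator_of_mem hyB, Pi.one_apply] at this
    have := h1.trans (Measure.le_sum (fun i => Measure.dirac (x i)) i B)
    rw [hB] at this
    exact absurd this (by simp)
  have hI : {i | x i ∈ U}.Finite := by
    rw [Measure.sum_apply _ hU.measurableSet] at hUfin
    have := ENNReal.finite_const_le_of_tsum_ne_top hUfin.ne one_ne_zero
    refine this.subset fun i hi => ?_
    simp [Measure.dirac_apply' _ hU.measurableSet, Set.indicator_of_mem (show x i ∈ U from hi)]
  -- Removing the finitely many atoms in `U` leaves an open null neighbourhood of `y`.
  have hV : IsOpen (U \ (x '' {i | x i ∈ U})) := hU.sdiff (hI.image x).isClosed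
  have hyV : y ∈ U \ (x '' {i | x i ∈ U}) := by
    refine ⟨hyU, ?_⟩
    rintro ⟨i, -, hi⟩
    exact hne i hi
  have hpos := (Measure.mem_support_iff_forall y).1 hy _ (hV.mem_nhds hyV)
  refine hpos.ne' ?_
  rw [Measure.sum_apply _ hV.measurableSet, ENNReal.tsum_eq_zero]
  intro i
  rw [Measure.dirac_apply' _ hV.measurableSet]
  exact Set.indicator_of_notMem (fun h => h.2 ⟨i, h.1, rfl⟩) _

/-- The void probability of a Poisson point process on a set of finite intensity is positive. -/
theorem IsPoissonPointProcess.void_not_null {Ω : Type*} [MeasurableSpace Ω] {P : Measure Ω}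
    {ξ : Ω → Measure E} {μ : Measure E} (hξ : IsPoissonPointProcess ξ μ P) {B : Set E}
    (hB : MeasurableSet B) (hμ : μ B ≠ ⊤) : ¬ ∀ᵐ ω ∂P, ξ ω B ≠ 0 := by
  intro h
  have hmeas : Measurable fun ω => ξ ω B := (Measure.measurable_coe hB).comp hξ.measurable
  have h0 : P.map (fun ω => ξ ω B) {0} = 0 := by
    rw [Measure.map_apply hmeas (measurableSet_singleton 0)]
    simp only [ae_iff, not_not] at h
    exact h
  rw [hξ.map_eq_poisson B hB hμ,
    Measure.map_apply (measurable_of_countable _) (measurableSet_singleton 0)] at h0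
  have h1 : poissonMeasure (μ B).toNNReal {0} = 0 :=
    measure_mono_null (by intro n hn; simpa using hn) h0
  rw [poissonMeasure_singleton] at h1
  have := ENNReal.ofReal_eq_zero.1 h1
  revert this
  simp only [imp_false, not_le]
  positivity

end PointMeasure

instance : IsFiniteMeasure directionLaw := by
  refine ⟨?_⟩
  rw [directionLaw, Measure.smul_apply, comap_subtype_coe_apply measurableSet_Ioc]
  simp only [Set.image_univ, Subtype.range_coe_subtype, Set.ofPred_mem_eq, Real.volume_Ioc, smul_eq_mul]
  refine ENNReal.mul_lt_top (ENNReal.inv_lt_top.2 ?_) ENNReal.ofReal_lt_top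
  exact ENNReal.ofReal_pos.2 Real.pi_pos

/-- The parameters of the ellipses which contain `p` after being scaled by `k⁻¹` about their
center. -/
def scaledHitting (k : ℝ) (p : Plane) : Set Params :=
  {s | k • (s.1 - p) ∈ ellipse 0 s.2.1 s.2.2}

theorem isClosed_scaledHitting (k : ℝ) (p : Plane) : IsClosed (scaledHitting k p) := by
  unfold scaledHitting ellipse
  refine isClosed_le (α := ℝ) (β := Params) (g := fun _ => 1) ?_ continuous_const
  have h : ∀ s : Params, ((s.2.1 : ℝ)) ≠ 0 := fun s =>
    (zero_lt_one.trans_le s.2.1.2).ne'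
  fun_prop (disch := exact h)

/-- For fixed shape, the admissible centers form a translate of the ellipse scaled by `k⁻¹`, whose
area is `k⁻²` times the original in the plane. -/
theorem intensity_scaledHitting (u : ℝ) (ρ : Measure AxisLength) [IsFiniteMeasure ρ] {k : ℝ}
    (hk : k ≠ 0) (p : Plane) :
    intensity u ρ (scaledHitting k p) =
      ENNReal.ofReal u * ENNReal.ofReal |(k ^ 2)⁻¹| * expectedArea ρ := by
  rw [intensity, Measure.prod_apply_symm (isClosed_scaledHitting k p).measurableSet, expectedArea,
    ← lintegral_const_mul' _ _ (by finiteness)]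
  refine lintegral_congr fun q => ?_
  have h : (fun z : Plane => (z, q)) ⁻¹' scaledHitting k p =
      (fun z => z - p) ⁻¹' ((fun z => k • z) ⁻¹' ellipse 0 q.1 q.2) := rfl
  have hsub : (fun z : Plane => z - p) = fun z => z + -p := funext fun z => sub_eq_add_neg z p
  rw [h, hsub, Measure.smul_apply, measure_preimage_add_right, Measure.addHaar_preimage_smul _ hk,
    finrank_euclideanSpace_fin, smul_eq_mul, mul_assoc]

theorem mem_scaledHitting_one_zero {s : Params} (h : (0 : Plane) ∈ ellipse s.1 s.2.1 s.2.2) :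
    s ∈ scaledHitting 1 0 := by
  simp only [scaledHitting, ellipse, Set.mem_ofPred_eq, one_smul, sub_zero, PiLp.zero_apply] at h ⊢
  -- Central symmetry: the squares absorb the sign change between `z` and `-z`.
  convert h using 1
  ring

/-- An ellipse contains the disc of radius `1 / 2` around every point of its concentric copy of
half the size. -/
theorem mem_ellipse_of_mem_scaledHitting {s : Params} {p x : Plane} (h : s ∈ scaledHitting 2 p)
    (hx : dist x p ≤ 1 / 2) : x ∈ ellipse s.1 s.2.1 s.2.2 := by
  obtain ⟨z, ⟨R, hR⟩, ⟨V, hV⟩⟩ := s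
  have hR1 : 1 ≤ R := hR
  simp only [scaledHitting, ellipse, Set.mem_ofPred_eq, sub_zero, PiLp.zero_apply,
    PiLp.smul_apply, PiLp.sub_apply, smul_eq_mul] at h ⊢
  have hd : (x 0 - p 0) ^ 2 + (x 1 - p 1) ^ 2 ≤ 1 / 4 := by
    have h2 : dist x p ^ 2 ≤ (1 / 2) ^ 2 := by gcongr
    rw [EuclideanSpace.dist_eq, Real.sq_sqrt (by positivity), Fin.sum_univ_two, Real.dist_eq,
      Real.dist_eq, sq_abs, sq_abs] at h2
    linarith
  set a := (p 0 - z 0) * Real.cos V + (p 1 - z 1) * Real.sin V with ha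
  set b := -(p 0 - z 0) * Real.sin V + (p 1 - z 1) * Real.cos V with hb
  set a' := (x 0 - p 0) * Real.cos V + (x 1 - p 1) * Real.sin V with ha'
  set b' := -(x 0 - p 0) * Real.sin V + (x 1 - p 1) * Real.cos V with hb'
  have e1 : (a / R) ^ 2 + b ^ 2 ≤ 1 / 4 := by
    have : 4 * ((a / R) ^ 2 + b ^ 2) ≤ 1 := by
      convert h using 1
      rw [ha, hb]
      ring
    linarith
  have e2 : a' ^ 2 + b' ^ 2 ≤ 1 / 4 := by
    have : a' ^ 2 + b' ^ 2 =
        ((x 0 - p 0) ^ 2 + (x 1 - p 1) ^ 2) * (Real.sin V ^ 2 + Real.cos V ^ 2) := by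
      rw [ha', hb']
      ring
    rwa [this, Real.sin_sq_add_cos_sq, mul_one]
  have e3 : (a' / R) ^ 2 ≤ a' ^ 2 := by
    rw [div_pow]
    exact div_le_self (sq_nonneg _) (one_le_pow₀ hR1)
  have e4 : (((x 0 - z 0) * Real.cos V + (x 1 - z 1) * Real.sin V) / R) = a / R + a' / R := by
    rw [ha, ha']
    ring
  have e5 : -(x 0 - z 0) * Real.sin V + (x 1 - z 1) * Real.cos V = b + b' := by
    rw [hb, hb']
    ring
  rw [e4, e5]
  -- By `(s + t)² ≤ 2s² + 2t²`, the sum is at most `2 (1/4 + 1/4) = 1`.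
  nlinarith [sq_nonneg (a / R - a' / R), sq_nonneg (b - b')]

end EllipsesModel

open EllipsesModel in
theorem expectedArea_eq_top_of_ae_covered {Ω : Type*} [MeasurableSpace Ω] {P : Measure Ω}
    {u : ℝ} {ρ : Measure AxisLength} [IsFiniteMeasure ρ] {ξ : Ω → Measure Params}
    (hξ : IsPoissonPointProcess ξ (intensity u ρ) P)
    (h : ∀ᵐ ω ∂P, coveredSet (ξ ω) = Set.univ) : expectedArea ρ = ⊤ := by
  by_contra htop
  refine hξ.void_not_null (isClosed_scaledHitting 1 0).measurableSet ?_ ?_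
  · rw [intensity_scaledHitting u ρ one_ne_zero]
    finiteness
  · filter_upwards [h] with ω hω
    have h0 : (0 : Plane) ∈ coveredSet (ξ ω) := hω ▸ Set.mem_univ _
    simp only [coveredSet, Set.mem_iUnion] at h0
    obtain ⟨s, hs, hs0⟩ := h0
    exact (hξ.isPointMeasure ω).measure_ne_zero_of_mem_support hs (mem_scaledHitting_one_zero hs0)

open EllipsesModel in
theorem ae_covered_of_expectedArea_eq_top {Ω : Type*} [MeasurableSpace Ω] {P : Measure Ω}
    {u : ℝ} (hu : 0 < u) {ρ : Measure AxisLength} [IsFiniteMeasure ρ] {ξ : Ω → Measure Params}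
    (hξ : IsPoissonPointProcess ξ (intensity u ρ) P) (h : expectedArea ρ = ⊤) :
    ∀ᵐ ω ∂P, coveredSet (ξ ω) = Set.univ := by
  have hB (p : Plane) : MeasurableSet (scaledHitting 2 p) :=
    (isClosed_scaledHitting 2 p).measurableSet
  have key (n : ℕ) : ∀ᵐ ω ∂P, ξ ω (scaledHitting 2 (TopologicalSpace.denseSeq Plane n)) = ⊤ := by
    refine hξ.ae_eq_top _ (hB _) ?_
    rw [intensity_scaledHitting u ρ two_ne_zero, h, ENNReal.mul_top]
    refine mul_ne_zero (ENNReal.ofReal_pos.2 hu).ne' (ENNReal.ofReal_pos.2 ?_).ne'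
    positivity
  filter_upwards [ae_all_iff.2 key] with ω hω
  refine Set.eq_univ_of_forall fun x => ?_
  obtain ⟨n, hn⟩ := (TopologicalSpace.denseRange_denseSeq Plane).exists_dist_lt x
    (one_half_pos (α := ℝ))
  obtain ⟨s, hs, hsupp⟩ := (hξ.isPointMeasure ω).exists_mem_support (hB _)
    (by rw [hω n]; exact ENNReal.top_ne_zero)
  simp only [coveredSet, Set.mem_iUnion]
  exact ⟨s, hsupp, mem_ellipse_of_mem_scaledHitting hs hn.le⟩

theorem mainTheorem5 {Ω : Type*} [MeasurableSpace Ω] (P : Measure Ω) [IsProbabilityMeasure P]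
    (u : ℝ) (hu : 0 < u) (α : ℝ) (hα : 0 < α)
    (ρ : Measure EllipsesModel.AxisLength) [IsProbabilityMeasure ρ]
    (hρ : EllipsesModel.HasTailDecay ρ α)
    (ξ : Ω → Measure EllipsesModel.Params)
    (hξ : EllipsesModel.IsPoissonPointProcess ξ (EllipsesModel.intensity u ρ) P) :
    (∀ᵐ ω ∂P, EllipsesModel.coveredSet (ξ ω) = Set.univ) ↔
      EllipsesModel.expectedArea ρ = ⊤ :=
  ⟨expectedArea_eq_top_of_ae_covered hξ, ae_covered_of_expectedArea_eq_top hu hξ⟩
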